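/- Consider an electric network with buses $1,\dots,n$, $n\ge 3$. Its lines are the edges $i\sim k$ of a simple graph $G$ on the buses; line $i\sim k$ has a nonzero complex admittance $y_{ik}=y_{ki}$, and bus $i$ has a shunt admittance $y_{ii}\in\mathbb{C}$ to ground (possibly $0$). The bus admittance matrix $Y\in\mathbb{C}^{n\times n}$ is given by $Y_{ii}=y_{ii}+\sum_{l\sim i}y_{il}$, $Y_{ik}=-y_{ik}$ if $i\sim k$, and $Y_{ik}=0$ if $i\ne k$ and $i\not\sim k$. The network is called lossless if all entries of $Y$ are purely imaginary (zero allowed). Let $\underline V_i,\overline V_i\ge 0$ be real lower and upper bounds on the voltage magnitudes, and define the voltage-constrained injection region $$\mathcal P=\{\,p\in\mathbb{R}^n : p=\operatorname{Re}\operatorname{diag}(vv^HY^H)\text{ for some } v\in\mathbb{C}^n \text{ with } \underline V_i\le |v_i|\le \overline V_i \text{ for all } i\,\}$$ and its semidefinite relaxation $$\widetilde{\mathcal P}=\{\,p\in\mathbb{R}^n : p=\operatorname{Re}\operatorname{diag}(WY^H)\text{ for some Hermitian } W\in\mathbb{C}^{n\times n},\ W\succeq 0, \text{ with } \underline V_i^2\le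 W_{ii}\le \overline V_i^2 \text{ for all } i\,\},$$ where $\operatorname{diag}(\cdot)$ is the vector of diagonal entries. If the network is lossless and $G$ is either a cycle through all $n$ buses, or such a cycle together with exactly one chord (one additional edge joining two buses that are not adjacent on the cycle), then $$\operatorname{conv}(\mathcal P)=\widetilde{\mathcal P}.$$ -/

import Mathlib

open scoped ComplexOrder Matrix

/-- An electric network with buses `Fin n`: a graph whose edges are the transmission lines, a
symmetric nonzero complex admittance `1 / z` on every line, and a shunt admittance to ground at
every bus (zero if there is no shunt element). The values of `lineAdmittance` at pairs of buses
that are not joined by a line play no role. -/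
structure PowerNetwork (n : ℕ) where
  graph : SimpleGraph (Fin n)
  lineAdmittance : Fin n → Fin n → ℂ
  shuntAdmittance : Fin n → ℂ
  lineAdmittance_symm : ∀ i k, graph.Adj i k → lineAdmittance i k = lineAdmittance k i
  lineAdmittance_ne_zero : ∀ i k, graph.Adj i k → lineAdmittance i k ≠ 0

namespace PowerNetwork

open Classical in
/-- The bus admittance matrix `Y` of the network. -/
noncomputable def busAdmittance {n : ℕ} (N : PowerNetwork n) : Matrix (Fin n) (Fin n) ℂ :=
  Matrix.of fun i k =>
    if i = k then
      (∑ l, if N.graph.Adj i l then N.lineAdmittance i l else 0) + N.shuntAdmittance i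
    else if N.graph.Adj i k then -N.lineAdmittance i k
    else 0

/-- The network is lossless: all entries of the bus admittance matrix are purely imaginary. -/
def IsLossless {n : ℕ} (N : PowerNetwork n) : Prop :=
  ∀ i k, (N.busAdmittance i k).re = 0

/-- The topology of the network is a cycle through all `n ≥ 3` buses. -/
def IsCycle {n : ℕ} (N : PowerNetwork n) : Prop :=
  3 ≤ n ∧ Nonempty (N.graph ≃g SimpleGraph.cycleGraph n)

/-- The topology of the network is a cycle through all buses together with exactly one chord, that
is, one further line, joining two distinct buses that are not neighbours on the cycle. -/
def IsCycleWithOneChord {n : ℕ} (N : PowerNetwork n) : Prop :=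
  3 ≤ n ∧ ∃ a b : Fin n, a ≠ b ∧ ¬ (SimpleGraph.cycleGraph n).Adj a b ∧
    Nonempty (N.graph ≃g SimpleGraph.cycleGraph n ⊔ SimpleGraph.edge a b)

/-- The vector `Re (diag (W Yᴴ))`; for `W = v vᴴ` it is the vector of real powers injected at the
buses when the vector of bus voltages is `v`. -/
noncomputable def realPower {n : ℕ} (N : PowerNetwork n) (W : Matrix (Fin n) (Fin n) ℂ) :
    Fin n → ℝ :=
  fun i => ((W * N.busAdmittanceᴴ).diag i).re

/-- The voltage constrained injection region: the real power vectors of all voltage vectors `v`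
with `Vlo i ≤ |v i| ≤ Vhi i` for every bus `i`. -/
def injectionRegion {n : ℕ} (N : PowerNetwork n) (Vlo Vhi : Fin n → ℝ) : Set (Fin n → ℝ) :=
  {p | ∃ v : Fin n → ℂ, (∀ i, Vlo i ≤ ‖v i‖ ∧ ‖v i‖ ≤ Vhi i) ∧
    p = N.realPower (Matrix.vecMulVec v (star v))}

/-- The semidefinite relaxation of the injection region. -/
def relaxedRegion {n : ℕ} (N : PowerNetwork n) (Vlo Vhi : Fin n → ℝ) : Set (Fin n → ℝ) :=
  {p | ∃ W : Matrix (Fin n) (Fin n) ℂ, W.PosSemidef ∧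
    (∀ i, Vlo i ^ 2 ≤ (W i i).re ∧ (W i i).re ≤ Vhi i ^ 2) ∧ p = N.realPower W}

end PowerNetwork

/-! The hull lies in the relaxed region because that region is convex. For the converse, a point
outside the compact hull could be strictly separated from it, so it suffices that no linear
functional does better on the relaxed region (`IsLossless.exists_injection_ge`).

Write `W` as a Gram matrix of vectors `x i`. In a lossless network the functional is a sum over
lines of `D i k * Im ⟨x i, x k⟩` with `D` antisymmetric. One needs complex numbers of the same norms
for which no term decreases; they are the voltages, up to conjugation. After normalising, a path of
unit vectors can be flattened by the spherical triangle inequality as soon as its ends satisfy one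
half-plane condition with axis-parallel boundary (`exists_flat_path`). A chord splits the cycle into
two paths with common ends, so the inner product of these ends has three such conditions to meet:
one per path and one for the chord. Three are always solvable on the unit circle
(`exists_unit_of_axes`). -/

/-! ### Flattening paths of unit vectors. -/

/-- A spherical triangle can be flattened onto the unit circle: a point of the circle can be placed
between two given ones without increasing the distances to its neighbours, provided the two given
points are at most as far apart as the original ones. -/
theorem exists_unit_between {E : Type*} [NormedAddCommGroup E] [InnerProductSpace ℂ E]
    {y₀ y₁ y₂ : E} (h₀ : ‖y₀‖ = 1) (h₁ : ‖y₁‖ = 1) (h₂ : ‖y₂‖ = 1)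
    {ω₁ ω₂ : ℂ} (hω₁ : ‖ω₁‖ = 1) (hω₂ : ‖ω₂‖ = 1)
    {w₀ w₂ : ℂ} (hw₀ : ‖w₀‖ = 1) (hw₂ : ‖w₂‖ = 1)
    (h : (ω₁ * ω₂ * inner ℂ y₀ y₂).re ≤ (ω₁ * ω₂ * inner ℂ w₀ w₂).re) :
    ∃ w₁ : ℂ, ‖w₁‖ = 1 ∧ (ω₁ * inner ℂ y₀ y₁).re ≤ (ω₁ * inner ℂ w₀ w₁).re ∧
      (ω₂ * inner ℂ y₁ y₂).re ≤ (ω₂ * inner ℂ w₁ w₂).re := by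
  let _ : InnerProductSpace ℝ E := InnerProductSpace.rclikeToReal ℂ E
  have hreal : ∀ x y : E, inner ℝ x y = (inner ℂ x y).re := fun x y => rfl
  have hcos : ∀ x y : E, ‖x‖ = 1 → ‖y‖ = 1 →
      Real.cos (InnerProductGeometry.angle x y) = (inner ℂ x y).re := by
    intro x y hx hy
    rw [InnerProductGeometry.cos_angle, hx, hy, hreal]; simp
  have hs₁ : ‖(starRingEnd ℂ ω₁) • y₀‖ = 1 := by simp [norm_smul, hω₁, h₀]
  have hs₂ : ‖ω₂ • y₂‖ = 1 := by simp [norm_smul, hω₂, h₂]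
  -- Absorbing `ω₁` and `ω₂` into the end vectors turns the three real parts into cosines of the
  -- sides of one spherical triangle.
  have htri := InnerProductGeometry.angle_le_angle_add_angle
    ((starRingEnd ℂ ω₁) • y₀) y₁ (ω₂ • y₂)
  have hα := hcos _ _ hs₁ h₁
  have hβ := hcos _ _ h₁ hs₂
  have hγ := hcos _ _ hs₁ hs₂
  have hα₀ := InnerProductGeometry.angle_nonneg ((starRingEnd ℂ ω₁) • y₀) y₁
  have hα₁ := InnerProductGeometry.angle_le_pi ((starRingEnd ℂ ω₁) • y₀) y₁
  have hβ₀ := InnerProductGeometry.angle_nonneg y₁ (ω₂ • y₂)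
  have hβ₁ := InnerProductGeometry.angle_le_pi y₁ (ω₂ • y₂)
  have hγ₀ := InnerProductGeometry.angle_nonneg ((starRingEnd ℂ ω₁) • y₀) (ω₂ • y₂)
  generalize InnerProductGeometry.angle ((starRingEnd ℂ ω₁) • y₀) y₁ = α at *
  generalize InnerProductGeometry.angle y₁ (ω₂ • y₂) = β at *
  generalize InnerProductGeometry.angle ((starRingEnd ℂ ω₁) • y₀) (ω₂ • y₂) = γ at *
  simp only [inner_smul_left, inner_smul_right, RingHomCompTriple.comp_apply, RingHom.id_apply,
    ← mul_assoc, mul_comm ω₂ ω₁] at hα hβ hγ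
  set t : ℂ := ω₁ * ω₂ * inner ℂ w₀ w₂ with ht
  have htn : ‖t‖ = 1 := by simp [ht, hω₁, hω₂, hw₀, hw₂]
  have hexp : t = Complex.exp (t.arg * Complex.I) := by
    have := Complex.norm_mul_exp_arg_mul_I t
    rwa [htn, Complex.ofReal_one, one_mul, eq_comm] at this
  have hre : t.re = Real.cos t.arg := by
    conv_lhs => rw [hexp]
    exact Complex.exp_ofReal_mul_I_re _
  have hφ : |t.arg| ≤ γ := by
    by_contra! hlt
    have := Real.cos_lt_cos_of_nonneg_of_le_pi hγ₀ (Complex.abs_arg_le_pi t) hlt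
    rw [Real.cos_abs] at this
    linarith
  -- `φ₁` is `t.arg` clamped to `[-α, α]`; the remainder is at most `β` because `|t.arg| ≤ α + β`.
  obtain ⟨φ₁, hφ₁, hφ₂⟩ : ∃ φ₁ : ℝ, |φ₁| ≤ α ∧ |t.arg - φ₁| ≤ β := by
    have h' := abs_le.1 (hφ.trans htri)
    rcases le_total t.arg (-α) with h1 | h1
    · exact ⟨-α, by rw [abs_neg, abs_of_nonneg hα₀], abs_le.2 ⟨by linarith, by linarith⟩⟩
    rcases le_total α t.arg with h2 | h2
    · exact ⟨α, by rw [abs_of_nonneg hα₀], abs_le.2 ⟨by linarith, by linarith⟩⟩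
    · exact ⟨t.arg, abs_le.2 ⟨h1, h2⟩, by simpa using hβ₀⟩
  have hle : ∀ a b : ℝ, |a| ≤ b → b ≤ Real.pi → Real.cos b ≤ Real.cos a := by
    intro a b hab hb
    rw [← Real.cos_abs a]
    exact Real.cos_le_cos_of_nonneg_of_le_pi (abs_nonneg a) hb hab
  have hmul : ∀ z : ℂ, ‖z‖ = 1 → z * starRingEnd ℂ z = 1 := by
    intro z hz
    rw [Complex.mul_conj, Complex.normSq_eq_norm_sq, hz]; simp
  -- Chosen so that `ω₁ * ⟨w₀, w₁⟩` has argument `φ₁`, which leaves `t.arg - φ₁` for `ω₂ * ⟨w₁,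
  -- w₂⟩`.
  refine ⟨w₀ * starRingEnd ℂ ω₁ * Complex.exp (φ₁ * Complex.I), ?_, ?_, ?_⟩
  · simp [hw₀, hω₁, Complex.norm_exp_ofReal_mul_I]
  · have : ω₁ * inner ℂ w₀ (w₀ * starRingEnd ℂ ω₁ * Complex.exp (φ₁ * Complex.I)) =
        Complex.exp (φ₁ * Complex.I) := by
      rw [RCLike.inner_apply]
      linear_combination Complex.exp (φ₁ * Complex.I) *
        (w₀ * starRingEnd ℂ w₀ * hmul _ hω₁ + hmul _ hw₀)
    rw [this, Complex.exp_ofReal_mul_I_re, ← hα]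
    exact hle _ _ hφ₁ hα₁
  · have : ω₂ * inner ℂ (w₀ * starRingEnd ℂ ω₁ * Complex.exp (φ₁ * Complex.I)) w₂ =
        Complex.exp ((t.arg - φ₁ : ℝ) * Complex.I) := by
      rw [Complex.ofReal_sub, sub_mul, sub_eq_add_neg, Complex.exp_add, ← hexp, ht,
        RCLike.inner_apply, RCLike.inner_apply]
      simp only [map_mul, ← Complex.exp_conj, Complex.conj_ofReal, Complex.conj_I, Complex.conj_conj,
        mul_neg]
      ring
    rw [this, Complex.exp_ofReal_mul_I_re, ← hβ]
    exact hle _ _ hφ₂ hβ₁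

/-- A fourth root of unity. -/
def IsAxis (ω : ℂ) : Prop := ω = 1 ∨ ω = -1 ∨ ω = Complex.I ∨ ω = -Complex.I

theorem IsAxis.norm_eq {ω : ℂ} (h : IsAxis ω) : ‖ω‖ = 1 := by
  rcases h with rfl | rfl | rfl | rfl <;> simp

theorem IsAxis.mul {ω ω' : ℂ} (h : IsAxis ω) (h' : IsAxis ω') : IsAxis (ω * ω') := by
  rcases h with rfl | rfl | rfl | rfl <;> rcases h' with rfl | rfl | rfl | rfl <;> simp [IsAxis]

theorem IsAxis.conj {ω : ℂ} (h : IsAxis ω) : IsAxis (starRingEnd ℂ ω) := by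
  rcases h with rfl | rfl | rfl | rfl <;> simp [IsAxis]

/-- The sign of `d * Im` is controlled by the real part after a quarter turn. -/
theorem exists_isAxis_mul_im_le (d : ℝ) :
    ∃ ω : ℂ, IsAxis ω ∧ ∀ s t : ℂ, (ω * s).re ≤ (ω * t).re → d * s.im ≤ d * t.im := by
  rcases le_total 0 d with hd | hd
  · refine ⟨-Complex.I, by simp [IsAxis], fun s t h => ?_⟩
    simp at h
    exact mul_le_mul_of_nonneg_left h hd
  · refine ⟨Complex.I, by simp [IsAxis], fun s t h => ?_⟩
    simp at h
    exact mul_le_mul_of_nonpos_left h hd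

/-- Flattening a path of unit vectors into the complex plane. -/
theorem exists_flat_path {E : Type*} [NormedAddCommGroup E] [InnerProductSpace ℂ E]
    (x : ℕ → E) (hx : ∀ k, ‖x k‖ = 1) (d : ℕ → ℝ) (l : ℕ) :
    ∃ ω : ℂ, IsAxis ω ∧ ∀ w₀ w₁ : ℂ, ‖w₀‖ = 1 → ‖w₁‖ = 1 →
      (ω * inner ℂ (x 0) (x l)).re ≤ (ω * inner ℂ w₀ w₁).re →
      ∃ z : ℕ → ℂ, z 0 = w₀ ∧ z l = w₁ ∧ (∀ k, ‖z k‖ = 1) ∧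
        ∀ k < l, d k * (inner ℂ (x k) (x (k + 1))).im ≤ d k * (inner ℂ (z k) (z (k + 1))).im := by
  induction l with
  | zero =>
    -- For the empty path the condition reads `1 ≤ Re ⟨w₀, w₁⟩`, which forces `w₀ = w₁`.
    refine ⟨1, by simp [IsAxis], fun w₀ w₁ h₀ h₁ h => ?_⟩
    have h' : inner ℂ w₀ w₁ = (1 : ℂ) := by
      have hn : (inner ℂ w₀ w₁ : ℂ).re ^ 2 + (inner ℂ w₀ w₁ : ℂ).im ^ 2 = 1 := by
        have : ‖(inner ℂ w₀ w₁ : ℂ)‖ ^ 2 = 1 := by simp [h₀, h₁]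
        rwa [Complex.sq_norm, Complex.normSq_apply, ← sq, ← sq] at this
      rw [inner_self_eq_norm_sq_to_K, hx 0] at h
      simp only [one_mul, map_one, one_pow, Complex.one_re] at h
      refine Complex.ext ?_ ?_
      · rw [Complex.one_re]
        nlinarith [sq_nonneg (inner ℂ w₀ w₁ : ℂ).im]
      · rw [Complex.one_im]
        nlinarith [sq_nonneg (inner ℂ w₀ w₁ : ℂ).im]
    have : w₀ = w₁ := (inner_eq_one_iff_of_norm_eq_one h₀ h₁).1 h'
    exact ⟨fun _ => w₀, rfl, this, fun _ => h₀, by simp⟩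
  | succ l ih =>
    obtain ⟨ω, hω, H⟩ := ih
    obtain ⟨ω', hω', H'⟩ := exists_isAxis_mul_im_le (d l)
    -- Each edge contributes a quarter turn, so the boundary of the half plane stays parallel to an
    -- axis.
    refine ⟨ω * ω', hω.mul hω', fun w₀ w₂ h₀ h₂ h => ?_⟩
    obtain ⟨w₁, hw₁, h01, h12⟩ := exists_unit_between (hx 0) (hx l) (hx (l + 1)) hω.norm_eq
      hω'.norm_eq h₀ h₂ h
    obtain ⟨z, hz0, hzl, hzn, hz⟩ := H w₀ w₁ h₀ hw₁ h01
    refine ⟨fun k => if k ≤ l then z k else w₂, by simpa using hz0, by simp, ?_, ?_⟩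
    · intro k
      dsimp only
      split_ifs
      exacts [hzn k, h₂]
    · intro k hk
      rcases Nat.lt_succ_iff_lt_or_eq.1 hk with hk | rfl
      · simpa [hk.le, Nat.succ_le_of_lt hk] using hz k hk
      · simpa [hzl] using H' _ _ h12

/-! ### Closing up: cycles with one chord. -/

/-- Three half planes through a point of the closed unit disc, each bounded by a horizontal or a
vertical line, have a common point on the unit circle. -/
theorem exists_unit_of_axes {ω₁ ω₂ ω₃ : ℂ} (h₁ : IsAxis ω₁) (h₂ : IsAxis ω₂) (h₃ : IsAxis ω₃)
    {c : ℂ} (hc : ‖c‖ ≤ 1) :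
    ∃ w : ℂ, ‖w‖ = 1 ∧ (ω₁ * c).re ≤ (ω₁ * w).re ∧ (ω₂ * c).re ≤ (ω₂ * w).re ∧
      (ω₃ * c).re ≤ (ω₃ * w).re := by
  have hsq : c.re ^ 2 + c.im ^ 2 ≤ 1 := by
    have := Complex.sq_norm c
    rw [Complex.normSq_apply] at this
    nlinarith [norm_nonneg c]
  set s := √(1 - c.im ^ 2) with hs
  set t := √(1 - c.re ^ 2) with ht
  have hs2 : s ^ 2 = 1 - c.im ^ 2 := Real.sq_sqrt (by nlinarith)
  have ht2 : t ^ 2 = 1 - c.re ^ 2 := Real.sq_sqrt (by nlinarith)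
  have hs' := abs_le.1 (Real.abs_le_sqrt (show c.re ^ 2 ≤ 1 - c.im ^ 2 by linarith))
  have ht' := abs_le.1 (Real.abs_le_sqrt (show c.im ^ 2 ≤ 1 - c.re ^ 2 by linarith))
  rw [← hs] at hs'
  rw [← ht] at ht'
  have hn : ∀ a b : ℝ, a ^ 2 + b ^ 2 = 1 → ‖(⟨a, b⟩ : ℂ)‖ = 1 := by
    intro a b hab
    rw [Complex.norm_eq_sqrt_sq_add_sq]
    simp [hab]
  -- The candidates are the points where the circle is reached from `c` in the directions `±1` and
  -- `±I`. A direction can fail a half plane only if it is opposite to the inner normal, so three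
  -- half planes exclude at most three of the four directions.
  have key : (((ω₁ * c).re ≤ (ω₁ * ⟨s, c.im⟩).re ∧ (ω₂ * c).re ≤ (ω₂ * ⟨s, c.im⟩).re ∧
      (ω₃ * c).re ≤ (ω₃ * ⟨s, c.im⟩).re) ∨ ((ω₁ * c).re ≤ (ω₁ * ⟨-s, c.im⟩).re ∧
      (ω₂ * c).re ≤ (ω₂ * ⟨-s, c.im⟩).re ∧ (ω₃ * c).re ≤ (ω₃ * ⟨-s, c.im⟩).re)) ∨
      (((ω₁ * c).re ≤ (ω₁ * ⟨c.re, t⟩).re ∧ (ω₂ * c).re ≤ (ω₂ * ⟨c.re, t⟩).re ∧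
      (ω₃ * c).re ≤ (ω₃ * ⟨c.re, t⟩).re) ∨ ((ω₁ * c).re ≤ (ω₁ * ⟨c.re, -t⟩).re ∧
      (ω₂ * c).re ≤ (ω₂ * ⟨c.re, -t⟩).re ∧ (ω₃ * c).re ≤ (ω₃ * ⟨c.re, -t⟩).re)) := by
    clear_value s t
    clear hs2 ht2 hn hsq hc
    obtain ⟨hs1, hs2⟩ := hs'
    obtain ⟨ht1, ht2⟩ := ht'
    have hs4 : -c.re ≤ s := by linarith
    have ht4 : -c.im ≤ t := by linarith
    rcases h₁ with rfl | rfl | rfl | rfl <;> rcases h₂ with rfl | rfl | rfl | rfl <;>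
      rcases h₃ with rfl | rfl | rfl | rfl <;> simp [hs2, hs4, ht2, ht4]
  rcases key with (h | h) | (h | h)
  · exact ⟨_, hn _ _ (by linarith), h⟩
  · exact ⟨_, hn _ _ (by linarith [neg_sq s]), h⟩
  · exact ⟨_, hn _ _ (by linarith), h⟩
  · exact ⟨_, hn _ _ (by linarith [neg_sq t]), h⟩

/-- Flattening a closed polygon of unit vectors together with one of its diagonals. -/
theorem exists_flat_polygon {E : Type*} [NormedAddCommGroup E] [InnerProductSpace ℂ E]
    (x : ℕ → E) (hx : ∀ k, ‖x k‖ = 1) (d : ℕ → ℝ) (c : ℝ) {m n : ℕ} (hmn : m ≤ n)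
    (hxn : x n = x 0) :
    ∃ z : ℕ → ℂ, z n = z 0 ∧ (∀ k, ‖z k‖ = 1) ∧
      (∀ k < n, d k * (inner ℂ (x k) (x (k + 1))).im ≤ d k * (inner ℂ (z k) (z (k + 1))).im) ∧
      c * (inner ℂ (x 0) (x m)).im ≤ c * (inner ℂ (z 0) (z m)).im := by
  obtain ⟨ω₁, h₁, H₁⟩ := exists_flat_path x hx d m
  obtain ⟨ω₂, h₂, H₂⟩ := exists_flat_path (fun k => x (m + k)) (fun k => hx _)
    (fun k => d (m + k)) (n - m)
  obtain ⟨ω₃, h₃, H₃⟩ := exists_isAxis_mul_im_le c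
  -- The second path runs back from `x m` to `x 0`, so its condition concerns the conjugate inner
  -- product.
  obtain ⟨w, hw, hw₁, hw₂, hw₃⟩ := exists_unit_of_axes h₁ h₂.conj h₃
    (c := inner ℂ (x 0) (x m)) (by simpa [hx] using norm_inner_le_norm (𝕜 := ℂ) (x 0) (x m))
  obtain ⟨z₁, hz10, hz1m, hz1n, hz1⟩ := H₁ 1 w (by simp) hw (by simpa using hw₁)
  obtain ⟨z₂, hz20, hz2m, hz2n, hz2⟩ := H₂ w 1 hw (by simp) (by
    simp only [add_zero, Nat.add_sub_cancel' hmn, hxn]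
    rw [← Complex.conj_re, ← Complex.conj_re (_ * inner ℂ w 1), map_mul, map_mul,
      inner_conj_symm, inner_conj_symm]
    simpa using hw₂)
  have hz0 : (if 0 ≤ m then z₁ 0 else z₂ (0 - m)) = 1 := by simpa using hz10
  refine ⟨fun k => if k ≤ m then z₁ k else z₂ (k - m), ?_, ?_, ?_, ?_⟩
  · dsimp only
    rw [hz0]
    split_ifs with h
    -- Here the second path is empty and its prescribed ends coincide, so `w = 1`.
    · obtain rfl : n = m := le_antisymm h hmn
      rw [Nat.sub_self, hz20] at hz2m
      rw [hz1m, hz2m]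
    · exact hz2m
  · intro k
    dsimp only
    split_ifs
    exacts [hz1n k, hz2n _]
  · intro k hk
    by_cases hkm : k < m
    · simpa [hkm.le, Nat.succ_le_of_lt hkm] using hz1 k hkm
    · have h2 := hz2 (k - m) (by omega)
      have e1 : m + (k - m) = k := by omega
      have e2 : m + (k - m + 1) = k + 1 := by omega
      have e3 : (if k ≤ m then z₁ k else z₂ (k - m)) = z₂ (k - m) := by
        split_ifs with h
        · obtain rfl : k = m := by omega
          rw [hz1m, Nat.sub_self, hz20]
        · rfl
      have e4 : ¬ k + 1 ≤ m := by omega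
      have e5 : k + 1 - m = k - m + 1 := by omega
      simp only [e1, e2] at h2
      simp only [e3, e4, if_false, e5]
      exact h2
  · refine H₃ _ _ ?_
    simpa [hz10, hz1m] using hw₃

/-- Flattening vectors indexed by the vertices of a cycle with a chord: the imaginary parts of the
inner products along the edges can be moved in any prescribed directions while the norms are
kept. -/
theorem exists_flat_cycle_sup_edge {E : Type*} [NormedAddCommGroup E] [InnerProductSpace ℂ E]
    {n : ℕ} (a b : Fin n) (x : Fin n → E) (hx : ∀ i, ‖x i‖ = 1) (D : Fin n → Fin n → ℝ)
    (hD : ∀ i k, D k i = -D i k) :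
    ∃ z : Fin n → ℂ, (∀ i, ‖z i‖ = 1) ∧
      ∀ i k, (SimpleGraph.cycleGraph n ⊔ SimpleGraph.edge a b).Adj i k →
        D i k * (inner ℂ (x i) (x k)).im ≤ D i k * (inner ℂ (z i) (z k)).im := by
  have : NeZero n := ⟨a.pos.ne'⟩
  -- The cycle is read off starting at `a`, which puts the chord between positions `0` and `b - a`.
  obtain ⟨z, hzn, hz1, hz, hzc⟩ := exists_flat_polygon (fun k => x (a + Fin.ofNat n k))
    (fun _ => hx _) (fun k => D (a + Fin.ofNat n k) (a + Fin.ofNat n (k + 1))) (D a b)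
    (m := (b - a).val) (n := n) (b - a).isLt.le (by simp)
  have hshift : ∀ i : Fin n, a + Fin.ofNat n (i - a).val = i := by
    intro i
    rw [Fin.ofNat_val_eq_self, add_sub_cancel]
  -- Both `D` and the imaginary part change sign with the orientation of an edge, so one orientation
  -- suffices.
  have hsymm : ∀ i k, D i k * (inner ℂ (x i) (x k)).im ≤
      D i k * (inner ℂ (z (i - a).val) (z (k - a).val)).im → D k i * (inner ℂ (x k) (x i)).im ≤
      D k i * (inner ℂ (z (k - a).val) (z (i - a).val)).im := by
    intro i k h
    rw [hD i k, ← inner_conj_symm (x k), ← inner_conj_symm (z (k - a).val), Complex.conj_im,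
      Complex.conj_im]
    linarith
  have hstep : ∀ i k : Fin n, (k - i).val = 1 → D i k * (inner ℂ (x i) (x k)).im ≤
      D i k * (inner ℂ (z (i - a).val) (z (k - a).val)).im := by
    intro i k hik
    have h := hz (i - a).val (i - a).isLt
    have hka : k - a = Fin.ofNat n ((i - a).val + 1) := by
      apply Fin.ext
      have : k - a = (i - a) + (k - i) := by abel
      rw [this, Fin.val_add, hik, Fin.val_ofNat]
    have hk : a + Fin.ofNat n ((i - a).val + 1) = k := by rw [← hka, add_sub_cancel]
    have hzk : z (k - a).val = z ((i - a).val + 1) := by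
      rw [hka, Fin.val_ofNat]
      rcases Nat.lt_or_ge ((i - a).val + 1) n with hlt | hge
      · rw [Nat.mod_eq_of_lt hlt]
      · have : (i - a).val + 1 = n := le_antisymm (i - a).isLt hge
        rw [this, Nat.mod_self, hzn]
    simp only [hshift, hk] at h
    rwa [hzk]
  have hchord : D a b * (inner ℂ (x a) (x b)).im ≤
      D a b * (inner ℂ (z (a - a).val) (z (b - a).val)).im := by
    have ha : a + Fin.ofNat n 0 = a := by simp
    simp only [hshift, ha] at hzc
    simpa only [sub_self, Fin.val_zero] using hzc
  refine ⟨fun i => z (i - a).val, fun i => hz1 _, fun i k hik => ?_⟩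
  rw [SimpleGraph.sup_adj, SimpleGraph.cycleGraph_adj', SimpleGraph.edge_adj] at hik
  rcases hik with (h | h) | ⟨⟨rfl, rfl⟩ | ⟨rfl, rfl⟩, -⟩
  · exact hsymm _ _ (hstep _ _ h)
  · exact hstep _ _ h
  · exact hchord
  · exact hsymm _ _ hchord

/-- Every vector of a nontrivial space is its norm times a unit vector. -/
theorem exists_unit_norm_smul {E : Type*} [NormedAddCommGroup E] [InnerProductSpace ℂ E]
    [Nontrivial E] (x : E) : ∃ y : E, ‖y‖ = 1 ∧ x = (‖x‖ : ℂ) • y := by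
  by_cases hx : x = 0
  · obtain ⟨e, he⟩ := exists_ne (0 : E)
    exact ⟨(‖e‖⁻¹ : ℂ) • e, norm_smul_inv_norm he, by simp [hx]⟩
  · refine ⟨(‖x‖⁻¹ : ℂ) • x, norm_smul_inv_norm hx, ?_⟩
    rw [smul_smul, mul_inv_cancel₀ (by simpa using hx), one_smul]

/-- Flattening vectors indexed by the vertices of a graph isomorphic to a cycle with a chord. -/
theorem exists_flat_of_iso {E : Type*} [NormedAddCommGroup E] [InnerProductSpace ℂ E]
    [Nontrivial E] {n : ℕ} {G : SimpleGraph (Fin n)} {a b : Fin n}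
    (φ : G ≃g SimpleGraph.cycleGraph n ⊔ SimpleGraph.edge a b) (x : Fin n → E)
    (D : Fin n → Fin n → ℝ) (hD : ∀ i k, D k i = -D i k) :
    ∃ z : Fin n → ℂ, (∀ i, ‖z i‖ = ‖x i‖) ∧ ∀ i k, G.Adj i k →
      D i k * (inner ℂ (x i) (x k)).im ≤ D i k * (inner ℂ (z i) (z k)).im := by
  choose y hy hxy using fun i => exists_unit_norm_smul (x i)
  obtain ⟨z, hz, hzD⟩ := exists_flat_cycle_sup_edge a b (fun j => y (φ.symm j)) (fun _ => hy _)
    (fun j l => D (φ.symm j) (φ.symm l)) (fun _ _ => hD _ _)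
  refine ⟨fun i => (‖x i‖ : ℂ) * z (φ i), fun i => by simp [hz], fun i k hik => ?_⟩
  have h := hzD (φ i) (φ k) (φ.map_adj_iff.2 hik)
  simp only [RelIso.symm_apply_apply] at h
  have hl : (inner ℂ (x i) (x k)).im = ‖x i‖ * ‖x k‖ * (inner ℂ (y i) (y k)).im := by
    conv_lhs => rw [hxy i, hxy k]
    rw [inner_smul_left, inner_smul_right, Complex.conj_ofReal, Complex.im_ofReal_mul,
      Complex.im_ofReal_mul, mul_assoc]
  have hr : (inner ℂ ((‖x i‖ : ℂ) * z (φ i)) ((‖x k‖ : ℂ) * z (φ k))).im =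
      ‖x i‖ * ‖x k‖ * (inner ℂ (z (φ i)) (z (φ k))).im := by
    rw [← smul_eq_mul, ← smul_eq_mul, inner_smul_left, inner_smul_right, Complex.conj_ofReal,
      Complex.im_ofReal_mul, Complex.im_ofReal_mul, mul_assoc]
  rw [hl, hr]
  have := mul_le_mul_of_nonneg_left h (mul_nonneg (norm_nonneg (x i)) (norm_nonneg (x k)))
  linarith

/-! ### Compact convex hulls and Gram vectors. -/

/-- In finite dimension the convex hull of a compact set is compact. -/
theorem isCompact_convexHull_of_isCompact {E : Type*} [NormedAddCommGroup E] [NormedSpace ℝ E]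
    [FiniteDimensional ℝ E] {s : Set E} (hs : IsCompact s) : IsCompact (convexHull ℝ s) := by
  -- By Carathéodory, `finrank + 1` points suffice, so the hull is a finite union of continuous
  -- images of compact sets.
  have key : convexHull ℝ s = ⋃ k ∈ Set.Iic (Module.finrank ℝ E + 1),
      (fun p : (Fin k → ℝ) × (Fin k → E) => ∑ i, p.1 i • p.2 i) ''
        (stdSimplex ℝ (Fin k) ×ˢ Set.univ.pi fun _ => s) := by
    apply Set.Subset.antisymm
    · intro x hx
      obtain ⟨ι, _, z, w, hz, hi, hw, hw1, rfl⟩ := eq_pos_convex_span_of_mem_convexHull hx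
      have hcard : Fintype.card ι ≤ Module.finrank ℝ E + 1 :=
        hi.card_le_finrank_succ.trans (Nat.succ_le_succ (Submodule.finrank_le _))
      let e := (Fintype.equivFin ι).symm
      refine Set.mem_biUnion (Set.mem_Iic.2 hcard)
        ⟨(w ∘ e, z ∘ e), ⟨⟨fun i => (hw _).le, ?_⟩, ?_⟩, ?_⟩
      · rw [← hw1]
        exact e.sum_comp w
      · exact fun i _ => hz ⟨_, rfl⟩
      · exact e.sum_comp fun i => w i • z i
    · refine Set.iUnion₂_subset fun k _ => ?_
      rintro _ ⟨⟨w, z⟩, ⟨hw, hz⟩, rfl⟩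
      exact (convex_convexHull ℝ s).sum_mem (fun i _ => hw.1 i) hw.2
        fun i _ => subset_convexHull ℝ s (hz i trivial)
  rw [key]
  refine (Set.finite_Iic _).isCompact_biUnion fun k _ => ?_
  refine ((isCompact_stdSimplex ℝ (Fin k)).prod (isCompact_univ_pi fun _ => hs)).image ?_
  fun_prop

/-- A positive semidefinite matrix is a Gram matrix. -/
theorem Matrix.PosSemidef.exists_gram {n : ℕ} {W : Matrix (Fin n) (Fin n) ℂ} (hW : W.PosSemidef) :
    ∃ x : Fin n → EuclideanSpace ℂ (Fin n), ∀ i k, W i k = inner ℂ (x i) (x k) := by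
  open scoped MatrixOrder in
  obtain ⟨B, rfl⟩ := CStarAlgebra.nonneg_iff_eq_star_mul_self.mp hW.nonneg
  refine ⟨fun i => WithLp.toLp 2 fun j => B j i, fun i k => ?_⟩
  simp [EuclideanSpace.inner_toLp_toLp, Matrix.mul_apply, dotProduct, mul_comm]

/-! ### Injection regions of lossless networks. -/

namespace PowerNetwork

variable {n : ℕ} (N : PowerNetwork n)

theorem busAdmittance_symm (i k : Fin n) : N.busAdmittance i k = N.busAdmittance k i := by
  by_cases h : i = k
  · rw [h]
  · by_cases hik : N.graph.Adj i k
    · simp [busAdmittance, h, Ne.symm h, hik, hik.symm, N.lineAdmittance_symm i k hik]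
    · have hki : ¬ N.graph.Adj k i := fun hki => hik hki.symm
      simp [busAdmittance, h, Ne.symm h, hik, hki]

theorem busAdmittance_eq_zero {i k : Fin n} (h : i ≠ k) (hik : ¬ N.graph.Adj i k) :
    N.busAdmittance i k = 0 := by
  simp [busAdmittance, h, hik]

variable {N}

theorem IsLossless.realPower_apply (hN : N.IsLossless) (W : Matrix (Fin n) (Fin n) ℂ)
    (i : Fin n) : N.realPower W i = ∑ k, (N.busAdmittance i k).im * (W i k).im := by
  simp only [realPower, Matrix.diag_apply, Matrix.mul_apply, Matrix.conjTranspose_apply,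
    Complex.re_sum]
  refine Finset.sum_congr rfl fun k _ => ?_
  simp [hN i k, mul_comm]

/-- A linear functional of the power vector is a sum over ordered pairs of buses. -/
theorem IsLossless.two_mul_sum_realPower (hN : N.IsLossless) {W : Matrix (Fin n) (Fin n) ℂ}
    (hW : ∀ i k, (W k i).im = -(W i k).im) (c : Fin n → ℝ) :
    2 * ∑ i, c i * N.realPower W i =
      ∑ i, ∑ k, (c i - c k) * (N.busAdmittance i k).im * (W i k).im := by
  have h1 : ∑ i, c i * N.realPower W i =
      ∑ i, ∑ k, c i * (N.busAdmittance i k).im * (W i k).im := by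
    refine Finset.sum_congr rfl fun i _ => ?_
    rw [hN.realPower_apply, Finset.mul_sum]
    exact Finset.sum_congr rfl fun k _ => by ring
  -- Swapping the two buses keeps the admittance and negates `Im W`; averaging both forms produces
  -- the antisymmetric weight `c i - c k`.
  have h2 : ∑ i, c i * N.realPower W i =
      ∑ i, ∑ k, -(c k * (N.busAdmittance i k).im * (W i k).im) := by
    rw [h1, Finset.sum_comm]
    refine Finset.sum_congr rfl fun i _ => Finset.sum_congr rfl fun k _ => ?_
    rw [N.busAdmittance_symm k i, hW i k]
    ring
  rw [two_mul]
  nth_rw 1 [h1]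
  rw [h2, ← Finset.sum_add_distrib]
  refine Finset.sum_congr rfl fun i _ => ?_
  rw [← Finset.sum_add_distrib]
  exact Finset.sum_congr rfl fun k _ => by ring

/-- Compactness makes the convex hull closed, as strict separation requires. -/
theorem IsLossless.isCompact_injectionRegion (hN : N.IsLossless) (Vlo Vhi : Fin n → ℝ) :
    IsCompact (N.injectionRegion Vlo Vhi) := by
  have himage : N.injectionRegion Vlo Vhi =
      (fun v : Fin n → ℂ => N.realPower (Matrix.vecMulVec v (star v))) ''
        Set.univ.pi fun i => {z : ℂ | Vlo i ≤ ‖z‖ ∧ ‖z‖ ≤ Vhi i} := by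
    ext p
    constructor
    · rintro ⟨v, hv, rfl⟩
      exact ⟨v, fun i _ => hv i, rfl⟩
    · rintro ⟨v, hv, rfl⟩
      exact ⟨v, fun i => hv i trivial, rfl⟩
  rw [himage]
  refine (isCompact_univ_pi fun i => ?_).image ?_
  · refine (isCompact_closedBall (0 : ℂ) (Vhi i)).of_isClosed_subset ?_ ?_
    · exact (isClosed_le continuous_const continuous_norm).inter
        (isClosed_le continuous_norm continuous_const)
    · intro z hz
      simpa using hz.2
  · refine continuous_pi fun i => ?_
    simp only [hN.realPower_apply, Matrix.vecMulVec_apply, Pi.star_apply]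
    fun_prop

theorem convex_relaxedRegion (N : PowerNetwork n) (Vlo Vhi : Fin n → ℝ) :
    Convex ℝ (N.relaxedRegion Vlo Vhi) := by
  rintro _ ⟨W, hW, hWb, rfl⟩ _ ⟨W', hW', hWb', rfl⟩ s t hs ht hst
  refine ⟨s • W + t • W', (hW.smul hs).add (hW'.smul ht), fun i => ?_, ?_⟩
  · obtain ⟨h1, h2⟩ := hWb i
    obtain ⟨h3, h4⟩ := hWb' i
    simp only [Matrix.add_apply, Matrix.smul_apply, Complex.add_re, Complex.smul_re, smul_eq_mul]
    obtain rfl : t = 1 - s := by linarith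
    constructor <;> nlinarith
  · ext i
    simp [realPower, add_mul]

theorem injectionRegion_subset_relaxedRegion (N : PowerNetwork n) {Vlo Vhi : Fin n → ℝ}
    (hlo : ∀ i, 0 ≤ Vlo i) : N.injectionRegion Vlo Vhi ⊆ N.relaxedRegion Vlo Vhi := by
  rintro _ ⟨v, hv, rfl⟩
  refine ⟨_, Matrix.posSemidef_vecMulVec_self_star v, fun i => ?_, rfl⟩
  have : (Matrix.vecMulVec v (star v) i i).re = ‖v i‖ ^ 2 := by
    rw [Matrix.vecMulVec_apply, Pi.star_apply, Complex.star_def, Complex.mul_conj,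
      Complex.ofReal_re, Complex.normSq_eq_norm_sq]
  rw [this]
  exact ⟨pow_le_pow_left₀ (hlo i) (hv i).1 2, pow_le_pow_left₀ (norm_nonneg _) (hv i).2 2⟩

/-- In a lossless network on a cycle with a chord, every linear functional takes on the injection
region a value at least as large as at a given point of the relaxed region. -/
theorem IsLossless.exists_injection_ge (hN : N.IsLossless) {a b : Fin n}
    (φ : N.graph ≃g SimpleGraph.cycleGraph n ⊔ SimpleGraph.edge a b) {Vlo Vhi : Fin n → ℝ}
    (hhi : ∀ i, 0 ≤ Vhi i) {p : Fin n → ℝ} (hp : p ∈ N.relaxedRegion Vlo Vhi) (c : Fin n → ℝ) :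
    ∃ q ∈ N.injectionRegion Vlo Vhi, ∑ i, c i * p i ≤ ∑ i, c i * q i := by
  obtain ⟨W, hW, hWb, rfl⟩ := hp
  obtain ⟨x, hx⟩ := hW.exists_gram
  have : Nonempty (Fin n) := ⟨a⟩
  obtain ⟨z, hz, hzD⟩ := exists_flat_of_iso φ x
    (fun i k => (c i - c k) * (N.busAdmittance i k).im) (fun i k => by
      rw [N.busAdmittance_symm k i]; ring)
  -- The inner product conjugates its first argument while `v vᴴ` conjugates the second factor,
  -- hence the voltages are `star z`.
  have hentry : ∀ i k, Matrix.vecMulVec (star z) (star (star z)) i k = inner ℂ (z i) (z k) := by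
    intro i k
    simp [Matrix.vecMulVec_apply, mul_comm]
  have hdiag : ∀ i, (W i i).re = ‖z i‖ ^ 2 := by
    intro i
    rw [hx, hz, inner_self_eq_norm_sq_to_K]
    norm_cast
  refine ⟨_, ⟨star z, fun i => ?_, rfl⟩, ?_⟩
  · have := hWb i
    rw [hdiag] at this
    rw [Pi.star_apply, norm_star]
    exact ⟨le_of_sq_le_sq this.1 (norm_nonneg _), le_of_sq_le_sq this.2 (hhi i)⟩
  · have h1 := hN.two_mul_sum_realPower (W := W)
      (fun i k => by rw [hx, hx, ← inner_conj_symm, Complex.conj_im]) c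
    have h2 := hN.two_mul_sum_realPower (W := Matrix.vecMulVec (star z) (star (star z)))
      (fun i k => by rw [hentry, hentry, ← inner_conj_symm, Complex.conj_im]) c
    have h3 : ∑ i, ∑ k, (c i - c k) * (N.busAdmittance i k).im * (W i k).im ≤
        ∑ i, ∑ k, (c i - c k) * (N.busAdmittance i k).im *
          (Matrix.vecMulVec (star z) (star (star z)) i k).im := by
      refine Finset.sum_le_sum fun i _ => Finset.sum_le_sum fun k _ => ?_
      rw [hentry, hx]
      by_cases hik : N.graph.Adj i k
      · exact hzD i k hik
      · by_cases h : i = k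
        · simp [h]
        · simp [N.busAdmittance_eq_zero h hik]
    linarith

/-- A cycle is a cycle with a chord that doubles one of its edges. -/
theorem exists_iso_cycle_sup_edge (htop : N.IsCycle ∨ N.IsCycleWithOneChord) :
    ∃ a b : Fin n, Nonempty (N.graph ≃g SimpleGraph.cycleGraph n ⊔ SimpleGraph.edge a b) := by
  rcases htop with ⟨hn, h⟩ | ⟨-, a, b, -, -, h⟩
  -- With equal ends, `SimpleGraph.edge` is the empty graph, so nothing is added to the cycle.
  · refine ⟨⟨0, by omega⟩, ⟨0, by omega⟩, ?_⟩
    simpa using h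
  · exact ⟨a, b, h⟩

end PowerNetwork

/-! ### Separation argument. -/

theorem theorem3 {n : ℕ} (N : PowerNetwork n) (Vlo Vhi : Fin n → ℝ)
    (hlo : ∀ i, 0 ≤ Vlo i) (hhi : ∀ i, 0 ≤ Vhi i)
    (hlossless : N.IsLossless) (htop : N.IsCycle ∨ N.IsCycleWithOneChord) :
    convexHull ℝ (N.injectionRegion Vlo Vhi) = N.relaxedRegion Vlo Vhi := by
  obtain ⟨a, b, ⟨φ⟩⟩ := PowerNetwork.exists_iso_cycle_sup_edge htop
  refine (convexHull_min (N.injectionRegion_subset_relaxedRegion hlo)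
    (N.convex_relaxedRegion Vlo Vhi)).antisymm fun p hp => ?_
  by_contra hnot
  obtain ⟨f, u, hfu, hup⟩ := geometric_hahn_banach_closed_point (convex_convexHull ℝ _)
    (isCompact_convexHull_of_isCompact (hlossless.isCompact_injectionRegion Vlo Vhi)).isClosed hnot
  have hf : ∀ q : Fin n → ℝ, f q = ∑ i, f (fun j => if i = j then 1 else 0) * q i := by
    intro q
    have := LinearMap.pi_apply_eq_sum_univ (f : (Fin n → ℝ) →ₗ[ℝ] ℝ) q
    simpa [mul_comm] using this
  obtain ⟨q, hq, hpq⟩ := hlossless.exists_injection_ge φ hhi hp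
    (fun i => f (fun j => if i = j then 1 else 0))
  rw [← hf, ← hf] at hpq
  linarith [hfu q (subset_convexHull ℝ _ hq)]
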